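/- Let $\mathcal C$ be a modular tensor category over $\mathbb C$: a $\mathbb C$-linear abelian, semisimple rigid monoidal category with bilinear tensor product, finite-dimensional morphism spaces, finitely many simple objects up to isomorphism and simple unit object, with a braiding $\beta$ and a twist $\theta$, i.e. an automorphism of the identity functor with $\theta_{X\otimes Y}=(\theta_X\otimes\theta_Y)\beta_{XY}^{-2}$ and $\theta_{X^*}=(\theta_X)^*$ (where $\beta_{XY}^2=\beta_{YX}\circ\beta_{XY}$), such that the matrix of categorical traces of $\beta_{XY}^2$, indexed by the isomorphism classes of simple objects $X,Y$, is non-degenerate. Let $D$ be the global dimension of $\mathcal C$, i.e. the sum of the squares of the categorical dimensions of the simple objects (up to isomorphism). Then: 1. $D$ is a positive real number and $D^{5/2}$ is an algebraic integer. 2. $\theta$ has finite order, and this order divides $D^{5/2}$ in the ring $\mathbb A$ of algebraic integers. 3. Equivalently, $\theta_X^{D^{5/2}}=1$ for every object $X$. Here, for an element $g$ of an abelian group $G$ and $a\in\mathbb A$, the equation $g^a=1$ means that $a\otimes g=0$ in $\mathbb A\otimes_{\mathbb Z}G$; for simple $X$ one regards $\theta_X$ as a scalar in $G=\mathbb C^*$,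 and for arbitrary $X$ as an element of the center $G$ of $\mathrm{Aut}(X)$. -/

import Mathlib

open CategoryTheory CategoryTheory.Limits MonoidalCategory
open scoped TensorProduct IsMulCommutative

noncomputable section

namespace VafaTwist

universe v u

attribute [local instance] Abelian.hasFiniteBiproducts

/-! ### Fusion categories over `ℂ` -/

/-- The set of isomorphism classes of simple objects of `C`, each given by its chosen
representative in the skeleton of `C`. -/
def SimpleClass (C : Type u) [Category.{v} C] [HasZeroMorphisms C] : Type u :=
  {X : Skeleton C // Simple ((fromSkeleton C).obj X)}

/-- A representative of a class of simple objects. -/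
def SimpleClass.rep {C : Type u} [Category.{v} C] [HasZeroMorphisms C] (i : SimpleClass C) : C :=
  (fromSkeleton C).obj i.1

/-- A finite semisimple rigid `ℂ`-linear abelian tensor category with simple unit object:
morphism spaces are finite dimensional, there are finitely many simple objects up to isomorphism,
and every object is a finite direct sum of simple objects. -/
class IsFusionCategory (C : Type u) [Category.{v} C] [Abelian C] [Linear ℂ C]
    [MonoidalCategory C] [MonoidalPreadditive C] [MonoidalLinear ℂ C] [RigidCategory C] :
    Prop where
  simple_unit : Simple (𝟙_ C)
  finiteDimensional_hom : ∀ X Y : C, FiniteDimensional ℂ (X ⟶ Y)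
  finite_simpleClass : Finite (SimpleClass C)
  semisimple : ∀ X : C, ∃ (n : ℕ) (S : Fin n → C),
    (∀ i, Simple (S i)) ∧ Nonempty (X ≅ ⨁ S)

/-! ### Ribbon categories -/

/-- A ribbon structure on a braided rigid category, that is a twist `θ`: an automorphism of the
identity functor with `θ_{X ⊗ Y} = (θ_X ⊗ θ_Y) β_{XY}⁻²` and `θ_{X*} = (θ_X)*`. Here `β_{XY}²`
is the double braiding `X ⊗ Y ⟶ Y ⊗ X ⟶ X ⊗ Y`. With this sign convention `θ⁻¹` satisfies
`θ⁻¹_{X ⊗ Y} = β_{XY}² (θ⁻¹_X ⊗ θ⁻¹_Y)`. -/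
class RibbonCategory (C : Type u) [Category.{v} C] [MonoidalCategory C] [BraidedCategory C]
    [RigidCategory C] where
  /-- The twist. -/
  twist : Aut (𝟭 C)
  twist_tensor : ∀ X Y : C,
    twist.hom.app (X ⊗ Y) ≫ (β_ X Y).hom ≫ (β_ Y X).hom =
      twist.hom.app X ⊗ₘ twist.hom.app Y
  twist_rightDual : ∀ X : C, twist.hom.app Xᘁ = (twist.hom.app X)ᘁ

section Ribbon

variable (C : Type u) [Category.{v} C] [MonoidalCategory C] [BraidedCategory C]
  [RigidCategory C] [RibbonCategory C]

/-- The twist `θ`, as an element of the group of automorphisms of the identity functor. -/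
def twist : Aut (𝟭 C) := RibbonCategory.twist

variable {C}

/-- The categorical trace of an endomorphism, valued in endomorphisms of the unit object:
`𝟙 ⟶ X ⊗ X* ⟶ X ⊗ X* ⟶ X* ⊗ X ⟶ 𝟙`, where the second arrow is `(f ∘ θ_X⁻¹) ⊗ id` and the third
one is the braiding (so `θ⁻¹` and the braiding together give the pivotal structure). -/
def ribbonTrace {X : C} (f : X ⟶ X) : 𝟙_ C ⟶ 𝟙_ C :=
  η_ X Xᘁ ≫ (((twist C).inv.app X ≫ f) ▷ Xᘁ) ≫ (β_ X Xᘁ).hom ≫ ε_ X Xᘁ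

/-- The component `θ_X` of the twist, as an automorphism of `X`. -/
def twistAut (X : C) : Aut X := (twist C).app X

theorem twistAut_mem_center (X : C) : twistAut X ∈ Subgroup.center (Aut X) := by
  rw [Subgroup.mem_center_iff]
  intro g
  ext
  exact ((twist C).hom.naturality g.hom).symm

/-- The component `θ_X` of the twist, as an element of the commutative group of central
automorphisms of `X`. -/
def twistAt (X : C) : Subgroup.center (Aut X) := ⟨twistAut X, twistAut_mem_center X⟩

end Ribbon

/-! ### Numerical traces, dimensions, the s-matrix -/

section Numerical

variable {C : Type u} [Category.{v} C] [Abelian C] [Linear ℂ C]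
  [MonoidalCategory C] [MonoidalPreadditive C] [MonoidalLinear ℂ C] [RigidCategory C]
  [IsFusionCategory C]

theorem exists_scalar (f : 𝟙_ C ⟶ 𝟙_ C) : ∃ c : ℂ, c • 𝟙 (𝟙_ C) = f :=
  haveI := IsFusionCategory.simple_unit (C := C)
  haveI := IsFusionCategory.finiteDimensional_hom (𝟙_ C) (𝟙_ C)
  endomorphism_simple_eq_smul_id ℂ f

/-- The unique scalar `c` with `f = c • 𝟙`, for an endomorphism `f` of the (simple) unit object. -/
def scalar (f : 𝟙_ C ⟶ 𝟙_ C) : ℂ := (exists_scalar f).choose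

theorem scalar_smul (f : 𝟙_ C ⟶ 𝟙_ C) : scalar f • 𝟙 (𝟙_ C) = f := (exists_scalar f).choose_spec

variable [BraidedCategory C] [RibbonCategory C]

/-- The categorical trace of an endomorphism, as a complex number. -/
def tr {X : C} (f : X ⟶ X) : ℂ := scalar (ribbonTrace f)

/-- The categorical dimension of an object. -/
def dim (X : C) : ℂ := tr (𝟙 X)

variable (C)

instance : Finite (SimpleClass C) := IsFusionCategory.finite_simpleClass

instance : Fintype (SimpleClass C) := Fintype.ofFinite _

instance : DecidableEq (SimpleClass C) := Classical.decEq _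

/-- The s-matrix: the trace of the double braiding of two simple objects. -/
def sMatrix : Matrix (SimpleClass C) (SimpleClass C) ℂ :=
  fun i j => tr ((β_ i.rep j.rep).hom ≫ (β_ j.rep i.rep).hom)

/-- The global dimension: the sum of squares of the categorical dimensions of the simple
objects (up to isomorphism). -/
def globalDim : ℂ := ∑ i : SimpleClass C, dim i.rep ^ 2

/-- A semisimple ribbon category is modular if its s-matrix is non-degenerate. -/
class IsModular : Prop where
  det_sMatrix_ne_zero : (sMatrix C).det ≠ 0

end Numerical

/-! ### Powers with algebraic integer exponents -/

/-- The ring of algebraic integers. -/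
abbrev AlgInt : Type := integralClosure ℤ ℂ

/-- `g ^ a = 1` for an element `g` of a commutative group `G` and an algebraic integer `a`. The
power `g ^ a` is the element `a ⊗ g` of the module obtained from the abelian group `G` (written
additively) by extension of scalars from `ℤ` to the algebraic integers. -/
def PowEqOne {G : Type*} [CommGroup G] (g : G) (a : AlgInt) : Prop :=
  a ⊗ₜ[ℤ] Additive.ofMul g = (0 : AlgInt ⊗[ℤ] Additive G)

end VafaTwist

end

/-!
Write `d_i`, `θ_i` for the dimension and the twist of the simple object `i`, `N_{ij}^k` for the
multiplicity of `k` in `i ⊗ j`, and `τ_i = 1 ⊗ θ_i` in the module `M = 𝔸 ⊗ ℂˣ` over the ring `𝔸`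
of algebraic integers. The goal is `D^{5/2} τ_i = 0` for all `i`.

On `(X ⊗ Y) ⊗ Z` the twist and the double braidings satisfy the lantern relation
`θ_{XYZ} (θ_X ⊗ θ_Y ⊗ θ_Z) = θ_{XY} θ_{XZ} θ_{YZ}`, up to conjugating the factors on the right by
braidings. Its action on `Hom(w, (i ⊗ j) ⊗ k)` has determinant
`(θ_w θ_i θ_j θ_k)^{N_{ijk}^w} = ∏_r θ_r^{N_{ij}^r N_{rk}^w + N_{ik}^r N_{rj}^w + N_{jk}^r N_{ir}^w}`
(`theta_pow_eq_prod`), which is a linear relation between the `τ_r`. Adding these relations with the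
weights `d_j d_k d_w`, for a fixed `i`, the identities
`∑_k N_{ij}^k d_k = d_i d_j` and `∑_j N_{ij}^k d_j = d_i d_k` make all terms cancel except
`D² d_i τ_i` (`weighted_sum`), so `D² d_i τ_i = 0` (`sq_globalDim_smul_tau`). Since
`D^{5/2} = (√D / d_i) · D² d_i`, it remains to see that `√D / d_i` is an algebraic integer
(`isIntegral_sqrt_div`).

This is where modularity enters. A loop coloured by `P` around a strand coloured by the simple
object `m` acts on it by a scalar `χ_m(P)`, and `χ_m` is a character of the fusion ring
(`chi_tensor`, `chi_eq_sum`) with `s_{mj} = d_m χ_m(j)` (`sMatrix_eq`). The values of a character are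
eigenvalues of matrices of natural numbers, so they are algebraic integers, and
`χ_m(j*)` is the complex conjugate of `χ_m(j)`; in particular the dimensions, which are the values
of the character of the unit object, are real, and `D > 0`. Non-degeneracy of the s-matrix separates
the characters and gives `D / d_m² = ∑_j χ_m(j) conj(χ_m(j))` (`dim_sq_mul_sum`), an algebraic
integer.

Finally, `𝔸` is flat over `ℤ`, so `a ⊗ g = 0` forces the order of `g` to divide `a`
(`PowEqOne.orderOf_dvd`). Applied to the tuple `(θ_i)_i`, which has the same order as `θ`, this gives
the divisibility, and the statements about single objects follow from it.
-/

noncomputable section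

namespace VafaTwist

universe v u

attribute [local instance] Abelian.hasFiniteBiproducts

/-! ### Partial traces and encircling loops in a ribbon category -/

section PartialTrace

variable {C : Type u} [Category.{v} C] [MonoidalCategory C]

/-- The mate `g'` of `g`, for arbitrary chosen duals of its source and target. -/
theorem exists_mate {X X' Y Y' : C} [ExactPairing X X'] [ExactPairing Y Y']
    (g : X ⟶ Y) : ∃ g' : Y' ⟶ X', η_ X X' ≫ g ▷ X' = η_ Y Y' ≫ Y ◁ g' ∧
      Y' ◁ g ≫ ε_ Y Y' = g' ▷ X ≫ ε_ X X' := by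
  let _ : HasRightDual X := ⟨X'⟩
  let _ : HasRightDual Y := ⟨Y'⟩
  exact ⟨gᘁ, (coevaluation_comp_rightAdjointMate g).symm, (rightAdjointMate_comp_evaluation g).symm⟩

variable [BraidedCategory C]

/-- A strand `X` that crosses both ends of a cap `c` can be pulled away from it. -/
theorem braiding_cap (X Y Y' : C) (c : Y ⊗ Y' ⟶ 𝟙_ C) :
    (β_ X Y).hom ▷ Y' ⊗≫ Y ◁ (β_ X Y').hom ⊗≫ c ▷ X =
      𝟙 _ ⊗≫ X ◁ c ⊗≫ 𝟙 _ := by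
  have h := BraidedCategory.braiding_naturality_right X c
  rw [BraidedCategory.braiding_tensor_right_hom, braiding_tensorUnit_right] at h
  calc _ = 𝟙 _ ⊗≫ (((α_ X Y Y').inv ≫ (β_ X Y).hom ▷ Y' ≫ (α_ Y X Y').hom ≫
        Y ◁ (β_ X Y').hom ≫ (α_ Y Y' X).inv) ≫ c ▷ X) ⊗≫ 𝟙 _ := by monoidal
    _ = _ := by rw [← h]; monoidal

/-- Up to a double braiding, the cap of `Z ⊗ X` made from the braiding and the evaluation is the cap
of `X` nested inside the cap of `Z`. The double braiding is moved past `X'`, after which the strand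
`X` is pulled off the cap of `Z`, and then `Z` off the cap of `X`. -/
theorem braiding_cap_tensor (Z Z' X X' : C) [ExactPairing Z Z'] [ExactPairing X X'] :
    ((β_ Z X).hom ≫ (β_ X Z).hom) ▷ (X' ⊗ Z') ≫ (β_ (Z ⊗ X) (X' ⊗ Z')).hom ≫
      ε_ (Z ⊗ X) (X' ⊗ Z') =
      𝟙 _ ⊗≫ Z ◁ ((β_ X X').hom ≫ ε_ X X') ▷ Z' ⊗≫ ((β_ Z Z').hom ≫ ε_ Z Z') := by
  have h1 := BraidedCategory.braiding_naturality_left ((β_ Z X).hom ≫ (β_ X Z).hom) X'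
  have h2 := braiding_cap X Z Z' ((β_ Z Z').hom ≫ ε_ Z Z')
  have h3 := braiding_cap Z X' X (ε_ X X')
  rw [ExactPairing.tensor_evaluation, BraidedCategory.braiding_tensor_right_hom]
  calc _ = 𝟙 _ ⊗≫ (((β_ Z X).hom ≫ (β_ X Z).hom) ▷ X' ≫ (β_ (Z ⊗ X) X').hom) ▷ Z' ⊗≫
        X' ◁ ((β_ (Z ⊗ X) Z').hom ⊗≫ ε_ Z Z' ▷ X) ⊗≫ ε_ X X' := by monoidal
    _ = 𝟙 _ ⊗≫ (β_ (Z ⊗ X) X').hom ▷ Z' ⊗≫ X' ◁ ((β_ Z X).hom ▷ Z' ⊗≫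
          ((β_ X Z).hom ▷ Z' ⊗≫ Z ◁ (β_ X Z').hom ⊗≫ ((β_ Z Z').hom ≫ ε_ Z Z') ▷ X)) ⊗≫
          ε_ X X' := by
      rw [h1, BraidedCategory.braiding_tensor_left_hom Z X Z']; monoidal
    _ = 𝟙 _ ⊗≫ Z ◁ (β_ X X').hom ▷ Z' ⊗≫ (β_ Z X').hom ▷ X ▷ Z' ⊗≫ X' ◁ (β_ Z X).hom ▷ Z' ⊗≫
          ((X' ⊗ X) ◁ ((β_ Z Z').hom ≫ ε_ Z Z') ≫ ε_ X X' ▷ 𝟙_ C) ⊗≫ 𝟙 _ := by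
      rw [h2, BraidedCategory.braiding_tensor_left_hom]; monoidal
    _ = 𝟙 _ ⊗≫ Z ◁ (β_ X X').hom ▷ Z' ⊗≫
          ((β_ Z X').hom ▷ X ⊗≫ X' ◁ (β_ Z X).hom ⊗≫ ε_ X X' ▷ Z) ▷ Z' ⊗≫
          ((β_ Z Z').hom ≫ ε_ Z Z') := by
      rw [whisker_exchange]; monoidal
    _ = _ := by rw [h3]; monoidal

variable [RigidCategory C] [RibbonCategory C]

/-- The component of the twist at `X`. -/
def tw (X : C) : X ⟶ X := (twist C).hom.app X

/-- The component of the inverse twist at `X`. -/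
def twInv (X : C) : X ⟶ X := (twist C).inv.app X

@[simp]
theorem tw_twInv (X : C) : tw X ≫ twInv X = 𝟙 X := Iso.hom_inv_id_app (twist C) X

@[simp]
theorem twInv_tw (X : C) : twInv X ≫ tw X = 𝟙 X := Iso.inv_hom_id_app (twist C) X

theorem tw_naturality {X Y : C} (g : X ⟶ Y) : g ≫ tw Y = tw X ≫ g :=
  (twist C).hom.naturality g

theorem twInv_naturality {X Y : C} (g : X ⟶ Y) : g ≫ twInv Y = twInv X ≫ g :=
  (twist C).inv.naturality g

@[simp]
theorem twInv_tw_assoc {X Y : C} (g : X ⟶ Y) : twInv X ≫ tw X ≫ g = g := by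
  rw [← Category.assoc, twInv_tw, Category.id_comp]

instance (X : C) : IsIso (tw X) := ⟨twInv X, by simp, by simp⟩

theorem tw_tensor (X Y : C) : tw (X ⊗ Y) ≫ (β_ X Y).hom ≫ (β_ Y X).hom = tw X ⊗ₘ tw Y :=
  RibbonCategory.twist_tensor X Y

theorem twInv_tensor (X Y : C) :
    twInv (X ⊗ Y) = (twInv X ⊗ₘ twInv Y) ≫ (β_ X Y).hom ≫ (β_ Y X).hom := by
  have h2 : (twInv X ⊗ₘ twInv Y) ≫ (tw X ⊗ₘ tw Y) = 𝟙 _ := by simp [tensorHom_comp_tensorHom]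
  have h3 : (β_ X Y).hom ≫ (β_ Y X).hom = twInv (X ⊗ Y) ≫ (tw X ⊗ₘ tw Y) := by
    rw [← tw_tensor, twInv_tw_assoc]
  rw [h3, ← Category.assoc, twInv_naturality, Category.assoc, h2, Category.comp_id]

theorem twInv_rightDual (X : C) : twInv Xᘁ = (twInv X)ᘁ := by
  have h : tw Xᘁ = (tw X)ᘁ := RibbonCategory.twist_rightDual X
  have h1 : tw Xᘁ ≫ (twInv X)ᘁ = 𝟙 _ := by
    rw [h, ← comp_rightAdjointMate, twInv_tw, rightAdjointMate_id]
  rw [← cancel_epi (tw Xᘁ), h1, tw_twInv]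

/-- The evaluation `X ⊗ X' ⟶ 𝟙` on the other side of a right dual `X'` of `X`, given by the pivotal
structure coming from the inverse twist and the braiding. -/
def rightEv (X X' : C) [ExactPairing X X'] : X ⊗ X' ⟶ 𝟙_ C :=
  twInv X ▷ X' ≫ (β_ X X').hom ≫ ε_ X X'

/-- The partial trace over the right tensor factor `X`, for a chosen right dual `X'` of `X`. The
trace `ribbonTrace` is the case `W = W' = 𝟙` (see `ptr_whiskerLeft`). -/
def ptr (X X' : C) [ExactPairing X X'] {W W' : C} (f : W ⊗ X ⟶ W' ⊗ X) : W ⟶ W' :=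
  (ρ_ W).inv ≫ W ◁ η_ X X' ≫ (α_ W X X').inv ≫ f ▷ X' ≫ (α_ W' X X').hom ≫
    W' ◁ rightEv X X' ≫ (ρ_ W').hom

/-- The partial trace is cyclic in the factor traced over. The duals of `X` and `Y` are arbitrary, so
for `g = 𝟙` this says that the partial trace does not depend on the dual. -/
theorem ptr_cyclic {X X' Y Y' : C} [ExactPairing X X'] [ExactPairing Y Y'] {W W' : C}
    (g : X ⟶ Y) (f : W ⊗ Y ⟶ W' ⊗ X) :
    ptr X X' (W ◁ g ≫ f) = ptr Y Y' (f ≫ W' ◁ g) := by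
  obtain ⟨g', h1, h2⟩ := exists_mate (X' := X') (Y' := Y') g
  have h3 : X ◁ g' ≫ rightEv X X' = g ▷ Y' ≫ rightEv Y Y' := by
    unfold rightEv
    calc X ◁ g' ≫ twInv X ▷ X' ≫ (β_ X X').hom ≫ ε_ X X'
        = twInv X ▷ Y' ≫ (X ◁ g' ≫ (β_ X X').hom) ≫ ε_ X X' := by
          rw [whisker_exchange_assoc, Category.assoc]
      _ = twInv X ▷ Y' ≫ (β_ X Y').hom ≫ Y' ◁ g ≫ ε_ Y Y' := by
          rw [BraidedCategory.braiding_naturality_right, h2, Category.assoc]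
      _ = (twInv X ≫ g) ▷ Y' ≫ (β_ Y Y').hom ≫ ε_ Y Y' := by
          rw [← BraidedCategory.braiding_naturality_left_assoc, comp_whiskerRight_assoc]
      _ = g ▷ Y' ≫ twInv Y ▷ Y' ≫ (β_ Y Y').hom ≫ ε_ Y Y' := by
          rw [← twInv_naturality, comp_whiskerRight_assoc]
  unfold ptr
  calc _ = (ρ_ W).inv ≫ W ◁ (η_ X X' ≫ g ▷ X') ≫ (α_ W Y X').inv ≫ f ▷ X' ≫ (α_ W' X X').hom ≫
    W' ◁ rightEv X X' ≫ (ρ_ W').hom := by monoidal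
    _ = (ρ_ W).inv ≫ W ◁ η_ Y Y' ≫ (α_ W Y Y').inv ≫ (W ⊗ Y) ◁ g' ≫ f ▷ X' ≫ (α_ W' X X').hom ≫
    W' ◁ rightEv X X' ≫ (ρ_ W').hom := by rw [h1]; monoidal
    _ = (ρ_ W).inv ≫ W ◁ η_ Y Y' ≫ (α_ W Y Y').inv ≫ f ▷ Y' ≫ (α_ W' X Y').hom ≫
    W' ◁ (X ◁ g' ≫ rightEv X X') ≫ (ρ_ W').hom := by rw [whisker_exchange_assoc]; monoidal
    _ = _ := by rw [h3]; monoidal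

theorem ptr_naturality_left {X X' : C} [ExactPairing X X'] {V W W' : C}
    (h : V ⟶ W) (f : W ⊗ X ⟶ W' ⊗ X) : ptr X X' (h ▷ X ≫ f) = h ≫ ptr X X' f := by
  unfold ptr
  calc _ = (ρ_ V).inv ≫ (V ◁ η_ X X' ≫ h ▷ (X ⊗ X')) ≫ (α_ W X X').inv ≫ f ▷ X' ≫
    (α_ W' X X').hom ≫ W' ◁ rightEv X X' ≫ (ρ_ W').hom := by monoidal
    _ = _ := by rw [whisker_exchange]; monoidal

theorem ptr_naturality_right {X X' : C} [ExactPairing X X'] {V W W' : C}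
    (h : W' ⟶ V) (f : W ⊗ X ⟶ W' ⊗ X) : ptr X X' (f ≫ h ▷ X) = ptr X X' f ≫ h := by
  unfold ptr
  calc _ = (ρ_ W).inv ≫ W ◁ η_ X X' ≫ (α_ W X X').inv ≫ f ▷ X' ≫
    (α_ W' X X').hom ≫ (h ▷ (X ⊗ X') ≫ V ◁ rightEv X X') ≫ (ρ_ V).hom := by monoidal
    _ = _ := by rw [← whisker_exchange]; monoidal

theorem ptr_whiskerLeft {X : C} (W : C) (g : X ⟶ X) :
    ptr X Xᘁ (W ◁ g) = (ρ_ W).inv ≫ W ◁ ribbonTrace g ≫ (ρ_ W).hom := by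
  unfold ptr ribbonTrace rightEv
  change _ = (ρ_ W).inv ≫ W ◁ (η_ X Xᘁ ≫ (twInv X ≫ g) ▷ Xᘁ ≫ (β_ X Xᘁ).hom ≫ ε_ X Xᘁ) ≫ _
  rw [← twInv_naturality]
  monoidal

theorem ribbonTrace_eq {X X' : C} [ExactPairing X X'] (g : X ⟶ X) :
    ribbonTrace g = η_ X X' ≫ g ▷ X' ≫ rightEv X X' := by
  have h1 : ptr X Xᘁ (𝟙_ C ◁ g) = ptr X X' (𝟙_ C ◁ g) := by
    simpa using ptr_cyclic (X' := Xᘁ) (Y' := X') (𝟙 X) (𝟙_ C ◁ g)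
  have h2 : ptr X X' (𝟙_ C ◁ g) =
    (ρ_ (𝟙_ C)).inv ≫ 𝟙_ C ◁ (η_ X X' ≫ g ▷ X' ≫ rightEv X X') ≫ (ρ_ (𝟙_ C)).hom := by
    unfold ptr
    monoidal
  rw [ptr_whiskerLeft, h2, cancel_epi, cancel_mono] at h1
  exact (MonoidalCategory.whiskerLeft_iff _ _).1 h1


/-- The pivotal structure is monoidal: the twist of `Z ⊗ X` supplies exactly the double braiding
needed in `braiding_cap_tensor`. -/
theorem rightEv_tensor (Z Z' X X' : C) [ExactPairing Z Z'] [ExactPairing X X'] :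
    rightEv (Z ⊗ X) (X' ⊗ Z') = 𝟙 _ ⊗≫ Z ◁ rightEv X X' ▷ Z' ⊗≫ rightEv Z Z' := by
  have h : (twInv Z ⊗ₘ twInv X) = Z ◁ twInv X ≫ twInv Z ▷ X := by
    rw [MonoidalCategory.tensorHom_def, whisker_exchange]
  unfold rightEv
  rw [twInv_tensor, comp_whiskerRight_assoc, braiding_cap_tensor, h]
  calc _ = 𝟙 _ ⊗≫ Z ◁ twInv X ▷ X' ▷ Z' ⊗≫ (twInv Z ▷ ((X ⊗ X') ⊗ Z') ≫
         Z ◁ (((β_ X X').hom ≫ ε_ X X') ▷ Z')) ⊗≫ ((β_ Z Z').hom ≫ ε_ Z Z') := by monoidal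
    _ = _ := by rw [← whisker_exchange]; monoidal

theorem ptr_tensor {Z Z' X X' W W' : C} [ExactPairing Z Z'] [ExactPairing X X']
    (f : W ⊗ (Z ⊗ X) ⟶ W' ⊗ (Z ⊗ X)) :
    ptr (Z ⊗ X) (X' ⊗ Z') f =
      ptr Z Z' (ptr X X' ((α_ W Z X).hom ≫ f ≫ (α_ W' Z X).inv)) := by
  unfold ptr
  rw [rightEv_tensor, ExactPairing.tensor_coevaluation]
  monoidal

/-- The trace is spherical. The dual `Xᘁ` is itself paired with `X` through the braiding; with that
pairing the two braidings cancel, and `θ_{X*} = (θ_X)*` moves the twist back to `X`. -/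
theorem ribbonTrace_rightDual (X : C) : ribbonTrace (𝟙 Xᘁ) = ribbonTrace (𝟙 X) := by
  let _ : ExactPairing Xᘁ X := BraidedCategory.exactPairing_swap X Xᘁ
  have h : ribbonTrace (𝟙 X) = η_ X Xᘁ ≫ rightEv X Xᘁ := by
    rw [ribbonTrace_eq (X' := Xᘁ), id_whiskerRight, Category.id_comp]
  rw [ribbonTrace_eq (X' := X), h]
  have h1 : η_ Xᘁ X = η_ X Xᘁ ≫ (β_ Xᘁ X).inv := rfl
  have h2 : ε_ Xᘁ X = (β_ X Xᘁ).hom ≫ ε_ X Xᘁ := rfl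
  have h3 : twInv Xᘁ ▷ X ≫ (β_ Xᘁ X).hom = (β_ Xᘁ X).hom ≫ X ◁ twInv Xᘁ := by simp
  have h4 := coevaluation_comp_rightAdjointMate (twInv X)
  rw [rightEv, h1, h2, id_whiskerRight, Category.id_comp, reassoc_of% h3, Category.assoc,
    Iso.inv_hom_id_assoc, twInv_rightDual, reassoc_of% h4]
  rfl

theorem ptr_eq_ptr {X X' X'' W W' : C} [ExactPairing X X'] [ExactPairing X X'']
    (f : W ⊗ X ⟶ W' ⊗ X) : ptr X X' f = ptr X X'' f := by
  simpa using ptr_cyclic (X' := X') (Y' := X'') (𝟙 X) f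

theorem ribbonTrace_comm {X Y : C} (f : X ⟶ Y) (g : Y ⟶ X) :
    ribbonTrace (f ≫ g) = ribbonTrace (g ≫ f) := by
  have h := ptr_cyclic (X' := Xᘁ) (Y' := Yᘁ) f (𝟙_ C ◁ g)
  rw [← MonoidalCategory.whiskerLeft_comp, ← MonoidalCategory.whiskerLeft_comp, ptr_whiskerLeft,
    ptr_whiskerLeft, cancel_epi, cancel_mono] at h
  exact (MonoidalCategory.whiskerLeft_iff _ _).1 h

theorem ribbonTrace_tensor {W X : C} (f : W ⊗ X ⟶ W ⊗ X) :
    ribbonTrace f = ribbonTrace (ptr X Xᘁ f) := by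
  have h := ptr_tensor (Z' := Wᘁ) (X' := Xᘁ) (𝟙_ C ◁ f)
  have h1 : ptr X Xᘁ ((α_ (𝟙_ C) W X).hom ≫ 𝟙_ C ◁ f ≫ (α_ (𝟙_ C) W X).inv) =
      𝟙_ C ◁ ptr X Xᘁ f := by
    unfold ptr
    monoidal
  rw [h1, ptr_whiskerLeft, ptr_eq_ptr (X'' := (W ⊗ X)ᘁ), ptr_whiskerLeft, cancel_epi,
    cancel_mono] at h
  exact (MonoidalCategory.whiskerLeft_iff _ _).1 h

/-- The endomorphism of `W` given by encircling the strand `W` by a loop coloured by `X`. -/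
def encircle (X W : C) : W ⟶ W := ptr X Xᘁ ((β_ W X).hom ≫ (β_ X W).hom)

theorem encircle_naturality (X : C) {W W' : C} (h : W ⟶ W') :
    h ≫ encircle X W' = encircle X W ≫ h := by
  unfold encircle
  rw [← ptr_naturality_left, ← ptr_naturality_right]
  simp

/-- A loop coloured by `X ⊗ Y` is a pair of parallel loops, which act one after the other. -/
theorem encircle_tensor (X Y W : C) : encircle (X ⊗ Y) W = encircle Y W ≫ encircle X W := by
  have h1 : (α_ W X Y).hom ≫ ((β_ W (X ⊗ Y)).hom ≫ (β_ (X ⊗ Y) W).hom) ≫ (α_ W X Y).inv =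
      (β_ W X).hom ▷ Y ≫ (α_ X W Y).hom ≫ X ◁ ((β_ W Y).hom ≫ (β_ Y W).hom) ≫
        (α_ X W Y).inv ≫ (β_ X W).hom ▷ Y := by
    simp
  have h2 : ptr Y Yᘁ ((α_ X W Y).hom ≫ X ◁ ((β_ W Y).hom ≫ (β_ Y W).hom) ≫
        (α_ X W Y).inv) = X ◁ encircle Y W := by
    unfold encircle ptr
    monoidal
  rw [encircle, ptr_eq_ptr (X'' := Yᘁ ⊗ Xᘁ), ptr_tensor, h1, ptr_naturality_left,
    ← Category.assoc, ← Category.assoc, ptr_naturality_right, Category.assoc, h2,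
    ← BraidedCategory.braiding_naturality_left_assoc, ptr_naturality_left]
  rfl

theorem encircle_unit (X : C) : encircle X (𝟙_ C) = ribbonTrace (𝟙 X) := by
  have h : (β_ (𝟙_ C) X).hom ≫ (β_ X (𝟙_ C)).hom = 𝟙_ C ◁ 𝟙 X := by
    simp [braiding_tensorUnit_left, braiding_tensorUnit_right]
  rw [encircle, h, ptr_whiskerLeft]
  monoidal

theorem ribbonTrace_braiding (W X : C) :
    ribbonTrace ((β_ W X).hom ≫ (β_ X W).hom) = ribbonTrace (encircle X W) :=
  ribbonTrace_tensor _

/-- The loop coloured by a retract `Y` of `X` is the loop coloured by `X` that carries the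
corresponding idempotent `g ≫ h`. -/
theorem encircle_retract (W : C) {X Y : C} (g : X ⟶ Y) (h : Y ⟶ X) (hg : h ≫ g = 𝟙 Y) :
    ptr X Xᘁ (W ◁ (g ≫ h) ≫ (β_ W X).hom ≫ (β_ X W).hom) = encircle Y W := by
  rw [MonoidalCategory.whiskerLeft_comp, Category.assoc, ptr_cyclic (Y' := Yᘁ), encircle]
  have : (W ◁ h ≫ (β_ W X).hom ≫ (β_ X W).hom) ≫ W ◁ g =
      W ◁ (h ≫ g) ≫ (β_ W Y).hom ≫ (β_ Y W).hom := by simp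
  rw [this, hg, MonoidalCategory.whiskerLeft_id, Category.id_comp]

theorem encircle_congr (W : C) {X Y : C} (e : X ≅ Y) : encircle X W = encircle Y W := by
  rw [← encircle_retract W e.hom e.inv e.inv_hom_id, e.hom_inv_id,
    MonoidalCategory.whiskerLeft_id, Category.id_comp, encircle]

end PartialTrace

/-! ### Multiplicities of simple objects -/

theorem det_pi_smul {ι : Type*} [Fintype ι] {M : ι → Type*}
    [∀ k, AddCommGroup (M k)] [∀ k, Module ℂ (M k)] [∀ k, FiniteDimensional ℂ (M k)]
    (t : ι → ℂ) :
    LinearMap.det (LinearMap.pi fun k => t k • LinearMap.proj (R := ℂ) (φ := M) k) =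
      ∏ k, t k ^ Module.finrank ℂ (M k) := by
  classical
  let b := Pi.basis fun k => Module.finBasis ℂ (M k)
  rw [← LinearMap.det_toMatrix b]
  have : LinearMap.toMatrix b b (LinearMap.pi fun k => t k • LinearMap.proj (R := ℂ) (φ := M) k) =
      Matrix.diagonal fun p => t p.1 := by
    ext p q
    rw [LinearMap.toMatrix_apply, Matrix.diagonal_apply]
    have : (LinearMap.pi fun k => t k • LinearMap.proj (R := ℂ) (φ := M) k) (b q) = t q.1 • b q := by
      ext k
      simp only [LinearMap.pi_apply, LinearMap.smul_apply, LinearMap.proj_apply, Pi.smul_apply, b,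
        Pi.basis_apply]
      by_cases h : k = q.1
      · subst h; rfl
      · simp [Pi.single_eq_of_ne h]
    rw [this, map_smul, Finsupp.smul_apply, b.repr_self, Finsupp.single_apply]
    by_cases h : p = q
    · subst h; simp
    · simp [h, Ne.symm h]
  rw [this, Matrix.det_diagonal, Fintype.prod_sigma]
  simp

section SimpleClass

variable {C : Type u} [Category.{v} C] [Abelian C]

instance simple_rep (i : SimpleClass C) : Simple i.rep := i.2

theorem exists_iso_rep (S : C) [Simple S] : ∃ i : SimpleClass C, Nonempty (S ≅ i.rep) := by
  refine ⟨⟨toSkeleton S, ?_⟩, ⟨(fromSkeletonToSkeletonIso S).symm⟩⟩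
  exact Simple.of_iso (fromSkeletonToSkeletonIso S)

theorem eq_of_rep_iso {i j : SimpleClass C} (e : i.rep ≅ j.rep) : i = j := by
  apply Subtype.ext
  rw [← toSkeleton_fromSkeleton_obj i.1, ← toSkeleton_fromSkeleton_obj j.1]
  exact congr_toSkeleton_of_iso e

end SimpleClass

section Linear

variable {C : Type u} [Category.{v} C] [Abelian C] [Linear ℂ C]

/-- Morphisms into the image of a finite direct sum under an additive functor are families of
morphisms. -/
def homMapBiproductEquiv (F : C ⥤ C) [F.Additive] (W : C) {n : ℕ} (S : Fin n → C) :
    (W ⟶ F.obj (⨁ S)) ≃ₗ[ℂ] (∀ k, W ⟶ F.obj (S k)) where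
  toFun f k := f ≫ F.map (biproduct.π S k)
  invFun g := ∑ k, g k ≫ F.map (biproduct.ι S k)
  map_add' f g := by ext k; simp
  map_smul' c f := by ext k; simp
  left_inv f := by
    simp only [Category.assoc, ← F.map_comp, ← Preadditive.comp_sum, ← F.map_sum,
      biproduct.total, F.map_id, Category.comp_id]
  right_inv g := by
    ext k
    simp only [Preadditive.sum_comp, Category.assoc, ← F.map_comp, biproduct.ι_π]
    rw [Finset.sum_eq_single k]
    · simp
    · intro j _ hj
      simp [hj]
    · simp

/-- Morphisms out of a finite direct sum are families of morphisms. -/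
def biproductHomEquiv (W : C) {n : ℕ} (S : Fin n → C) :
    (⨁ S ⟶ W) ≃ₗ[ℂ] (∀ k, S k ⟶ W) where
  toFun f k := biproduct.ι S k ≫ f
  invFun g := biproduct.desc g
  map_add' f g := by ext k; simp
  map_smul' c f := by ext k; simp
  left_inv f := by ext; simp
  right_inv g := by ext; simp

theorem finrank_hom_congr {X X' Y Y' : C} (e : X ≅ X') (f : Y ≅ Y') :
    Module.finrank ℂ (X ⟶ Y) = Module.finrank ℂ (X' ⟶ Y') :=
  (Linear.homCongr ℂ e f).finrank_eq

/-- The determinant of composition with `g` on the space of morphisms from `W` to `P`. -/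
def detHom (W : C) {P : C} (g : P ⟶ P) : ℂ := LinearMap.det (Linear.rightComp ℂ W g)

theorem detHom_comp (W : C) {P : C} (g h : P ⟶ P) : detHom W (g ≫ h) = detHom W g * detHom W h := by
  unfold detHom
  rw [mul_comm, ← LinearMap.det_comp]
  congr 1
  ext f
  simp

theorem detHom_conj (W : C) {P Q : C} (e : P ≅ Q) (g : Q ⟶ Q) :
    detHom W (e.hom ≫ g ≫ e.inv) = detHom W g := by
  unfold detHom
  rw [← LinearMap.det_conj (Linear.rightComp ℂ W g) (Linear.homCongr ℂ (Iso.refl W) e.symm)]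
  congr 1
  ext f
  simp [Linear.homCongr_apply, Linear.homCongr_symm_apply]

theorem detHom_smul_id (W P : C) (c : ℂ) :
    detHom W (c • 𝟙 P) = c ^ Module.finrank ℂ (W ⟶ P) := by
  have : Linear.rightComp ℂ W (c • 𝟙 P) = c • LinearMap.id := by ext; simp
  rw [detHom, this, LinearMap.det_smul, LinearMap.det_id, mul_one]

theorem smul_id_injective (X : C) [Simple X] {c d : ℂ} (h : c • 𝟙 X = d • 𝟙 X) : c = d :=
  smul_left_injective ℂ (id_nonzero X) h

end Linear

section Semisimple

variable {C : Type u} [Category.{v} C] [Abelian C] [Linear ℂ C]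

/-- The multiplicity of the simple object `i` in `P`. -/
def mult (i : SimpleClass C) (P : C) : ℕ := Module.finrank ℂ (i.rep ⟶ P)

variable [MonoidalCategory C] [MonoidalPreadditive C] [MonoidalLinear ℂ C] [RigidCategory C]
  [IsFusionCategory C]

instance (X Y : C) : FiniteDimensional ℂ (X ⟶ Y) := IsFusionCategory.finiteDimensional_hom X Y

theorem mult_rep (i j : SimpleClass C) : mult i j.rep = if i = j then 1 else 0 := by
  unfold mult
  split_ifs with h
  · subst h
    exact finrank_endomorphism_simple_eq_one ℂ _
  · exact finrank_hom_simple_simple_eq_zero_of_not_iso ℂ fun e => h (eq_of_rep_iso e)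

theorem exists_decomposition (P : C) :
    ∃ (n : ℕ) (c : Fin n → SimpleClass C), Nonempty (P ≅ ⨁ fun k => (c k).rep) := by
  obtain ⟨n, S, hS, ⟨e⟩⟩ := IsFusionCategory.semisimple P
  choose c hc using fun k => haveI := hS k; exists_iso_rep (S k)
  exact ⟨n, c, ⟨e ≪≫ biproduct.mapIso fun k => (hc k).some⟩⟩

theorem finrank_hom_map_biproduct (F : C ⥤ C) [F.Additive] (W : C) {n : ℕ} (S : Fin n → C) :
    Module.finrank ℂ (W ⟶ F.obj (⨁ S)) = ∑ k, Module.finrank ℂ (W ⟶ F.obj (S k)) := by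
  rw [(homMapBiproductEquiv F W S).finrank_eq, Module.finrank_pi_fintype]

theorem mult_eq_card {P : C} {n : ℕ} {c : Fin n → SimpleClass C}
    (e : P ≅ ⨁ fun k => (c k).rep) (i : SimpleClass C) :
    mult i P = (Finset.univ.filter fun k => c k = i).card := by
  have h := finrank_hom_map_biproduct (𝟭 C) i.rep fun k => (c k).rep
  have h1 : mult i P = Module.finrank ℂ (i.rep ⟶ (𝟭 C).obj (⨁ fun k => (c k).rep)) :=
    finrank_hom_congr (Iso.refl _) e
  rw [h1, h, Finset.card_filter]
  exact Finset.sum_congr rfl fun k _ => by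
    refine (mult_rep i (c k)).trans ?_
    simp only [eq_comm]

/-- The sum of a function over the simple summands of `P`, counted by multiplicities. -/
theorem sum_decomposition {P : C} {n : ℕ} {c : Fin n → SimpleClass C}
    (e : P ≅ ⨁ fun k => (c k).rep) {A : Type*} [AddCommMonoid A] (f : SimpleClass C → A) :
    ∑ k, f (c k) = ∑ i, mult i P • f i := by
  rw [← Finset.sum_fiberwise Finset.univ c fun k => f (c k)]
  refine Finset.sum_congr rfl fun i _ => ?_
  rw [mult_eq_card e, ← Finset.sum_const]
  exact Finset.sum_congr rfl fun k hk => by rw [(Finset.mem_filter.1 hk).2]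

theorem finrank_hom_map (F : C ⥤ C) [F.Additive] (W P : C) :
    Module.finrank ℂ (W ⟶ F.obj P) = ∑ i, mult i P * Module.finrank ℂ (W ⟶ F.obj i.rep) := by
  obtain ⟨n, c, ⟨e⟩⟩ := exists_decomposition P
  rw [finrank_hom_congr (Iso.refl W) (F.mapIso e), finrank_hom_map_biproduct,
    sum_decomposition e fun i => Module.finrank ℂ (W ⟶ F.obj i.rep)]
  simp

theorem finrank_hom_eq (P Q : C) :
    Module.finrank ℂ (P ⟶ Q) = ∑ i : SimpleClass C, mult i P * mult i Q := by
  obtain ⟨n, c, ⟨e⟩⟩ := exists_decomposition P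
  rw [finrank_hom_congr e (Iso.refl Q), (biproductHomEquiv Q _).finrank_eq,
    Module.finrank_pi_fintype]
  exact sum_decomposition e fun i => mult i Q

theorem finrank_hom_comm (P Q : C) :
    Module.finrank ℂ (P ⟶ Q) = Module.finrank ℂ (Q ⟶ P) := by
  simp only [finrank_hom_eq, mul_comm]

/-- If a natural endomorphism `α` of the identity is the scalar `t i` on each simple object `i`, then
the action of `F.map (α.app P)` on the morphisms from `W` to `F.obj P` is diagonal for the
decomposition of `P` into simple objects. -/
theorem detHom_map (F : C ⥤ C) [F.Additive] [F.Linear ℂ] (W : C) (α : 𝟭 C ⟶ 𝟭 C)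
    (t : SimpleClass C → ℂ) (ht : ∀ i : SimpleClass C, α.app i.rep = t i • 𝟙 i.rep) (P : C) :
    detHom W (F.map (α.app P)) =
      ∏ i, t i ^ (mult i P * Module.finrank ℂ (W ⟶ F.obj i.rep)) := by
  obtain ⟨n, c, ⟨e⟩⟩ := exists_decomposition P
  set S : Fin n → C := fun k => (c k).rep
  have h1 : F.map (α.app P) =
      (F.mapIso e).hom ≫ F.map (α.app (⨁ S)) ≫ (F.mapIso e).inv := by
    have := α.naturality e.hom
    simp only [Functor.id_map] at this
    simp only [Functor.mapIso_hom, Functor.mapIso_inv, ← F.map_comp]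
    rw [← Category.assoc, this]
    simp
  have h2 : (homMapBiproductEquiv F W S).toLinearMap ∘ₗ
      Linear.rightComp ℂ W (F.map (α.app (⨁ S))) ∘ₗ (homMapBiproductEquiv F W S).symm.toLinearMap =
      LinearMap.pi fun k => t (c k) • LinearMap.proj k := by
    refine LinearMap.ext fun v => funext fun k => ?_
    obtain ⟨f, rfl⟩ := (homMapBiproductEquiv F W S).surjective v
    have h3 : α.app (⨁ S) ≫ biproduct.π S k = biproduct.π S k ≫ α.app (S k) :=
      (α.naturality (biproduct.π S k)).symm
    have h4 : α.app (S k) = t (c k) • 𝟙 (S k) := ht (c k)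
    have h5 : (f ≫ F.map (α.app (⨁ S))) ≫ F.map (biproduct.π S k) =
        t (c k) • (f ≫ F.map (biproduct.π S k)) := by
      have h6 : F.map (α.app (⨁ S)) ≫ F.map (biproduct.π S k) =
          t (c k) • F.map (biproduct.π S k) := by
        rw [← F.map_comp, ← F.map_smul]
        exact congrArg F.map (h3.trans (by rw [h4, Linear.comp_smul, Category.comp_id]))
      rw [Category.assoc, h6, Linear.comp_smul]
    simp only [LinearMap.comp_apply, LinearEquiv.coe_coe, LinearEquiv.symm_apply_apply]
    exact h5
  rw [h1, detHom_conj, detHom, ← LinearMap.det_conj _ (homMapBiproductEquiv F W S), h2, det_pi_smul]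
  have h := sum_decomposition e (A := Additive ℂ) fun i =>
    Additive.ofMul (t i ^ Module.finrank ℂ (W ⟶ F.obj i.rep))
  simp only [← ofMul_prod, ← ofMul_pow] at h
  refine (Additive.ofMul.injective h).trans ?_
  exact Finset.prod_congr rfl fun i _ => by rw [← pow_mul, mul_comm]

end Semisimple

/-! ### Characters of the fusion ring -/

section AdditiveLoops

variable {C : Type u} [Category.{v} C] [Preadditive C] [MonoidalCategory C] [MonoidalPreadditive C]
  [BraidedCategory C] [RigidCategory C] [RibbonCategory C]

theorem ptr_sum {X X' : C} [ExactPairing X X'] {W W' : C} {n : ℕ}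
    (f : Fin n → (W ⊗ X ⟶ W' ⊗ X)) : ptr X X' (∑ k, f k) = ∑ k, ptr X X' (f k) := by
  simp only [ptr, sum_whiskerRight, Preadditive.comp_sum, Preadditive.sum_comp]

theorem encircle_biproduct [HasFiniteBiproducts C] (W : C) {n : ℕ} (S : Fin n → C) :
    encircle (⨁ S) W = ∑ k, encircle (S k) W := by
  have h : (β_ W (⨁ S)).hom ≫ (β_ (⨁ S) W).hom = ∑ k,
      W ◁ (biproduct.π S k ≫ biproduct.ι S k) ≫ (β_ W (⨁ S)).hom ≫ (β_ (⨁ S) W).hom := by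
    rw [← Preadditive.sum_comp, ← whiskerLeft_sum, biproduct.total,
      MonoidalCategory.whiskerLeft_id, Category.id_comp]
  rw [encircle, h, ptr_sum]
  exact Finset.sum_congr rfl fun k _ => encircle_retract W _ _ (biproduct.ι_π_self S k)

end AdditiveLoops

section Characters

variable {C : Type u} [Category.{v} C] [Abelian C] [Linear ℂ C]
  [MonoidalCategory C] [MonoidalPreadditive C] [MonoidalLinear ℂ C] [RigidCategory C]
  [IsFusionCategory C]

theorem exists_smul_id (i : SimpleClass C) (f : i.rep ⟶ i.rep) : ∃ c : ℂ, c • 𝟙 i.rep = f :=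
  endomorphism_simple_eq_smul_id ℂ f

theorem scalar_eq {f : 𝟙_ C ⟶ 𝟙_ C} {c : ℂ} (h : f = c • 𝟙 _) : scalar f = c :=
  haveI := IsFusionCategory.simple_unit (C := C)
  smul_id_injective (𝟙_ C) ((scalar_smul f).trans h)

variable (C) in
/-- The class of the unit object. -/
def unitClass : SimpleClass C :=
  haveI := IsFusionCategory.simple_unit (C := C)
  (exists_iso_rep (𝟙_ C)).choose

variable (C) in
/-- The isomorphism of the unit object with its representative. -/
def unitIso : 𝟙_ C ≅ (unitClass C).rep :=
  haveI := IsFusionCategory.simple_unit (C := C)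
  (exists_iso_rep (𝟙_ C)).choose_spec.some

variable [BraidedCategory C] [RibbonCategory C]

theorem ribbonTrace_eq_tr {X : C} (f : X ⟶ X) : ribbonTrace f = tr f • 𝟙 (𝟙_ C) :=
  (scalar_smul _).symm

theorem tr_comm {X Y : C} (f : X ⟶ Y) (g : Y ⟶ X) : tr (f ≫ g) = tr (g ≫ f) := by
  rw [tr, tr, ribbonTrace_comm]

theorem tr_smul_id (X : C) (c : ℂ) : tr (c • 𝟙 X) = c * dim X := by
  refine scalar_eq ?_
  have h := ribbonTrace_eq_tr (𝟙 X)
  rw [← dim] at h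
  rw [mul_smul, ← h]
  simp [ribbonTrace]

theorem dim_rightDual (X : C) : dim Xᘁ = dim X := by
  rw [dim, dim, tr, tr, ribbonTrace_rightDual]

theorem exists_chi (m : SimpleClass C) (P : C) : ∃ c : ℂ, c • 𝟙 m.rep = encircle P m.rep :=
  exists_smul_id m _

/-- The scalar by which a loop coloured by `P` acts on the simple object `m` that it encircles. -/
def chi (m : SimpleClass C) (P : C) : ℂ := (exists_chi m P).choose

theorem chi_smul (m : SimpleClass C) (P : C) : chi m P • 𝟙 m.rep = encircle P m.rep :=
  (exists_chi m P).choose_spec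

theorem chi_eq {m : SimpleClass C} {P : C} {c : ℂ} (h : encircle P m.rep = c • 𝟙 _) :
    chi m P = c := smul_id_injective m.rep ((chi_smul m P).trans h)

theorem chi_tensor (m : SimpleClass C) (P Q : C) : chi m (P ⊗ Q) = chi m P * chi m Q := by
  refine chi_eq ?_
  rw [encircle_tensor, ← chi_smul, ← chi_smul, Linear.smul_comp, Linear.comp_smul,
    Category.comp_id, smul_smul, mul_comm]

theorem chi_eq_sum (m : SimpleClass C) (P : C) : chi m P = ∑ i, mult i P * chi m i.rep := by
  obtain ⟨n, c, ⟨e⟩⟩ := exists_decomposition P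
  refine chi_eq ?_
  rw [encircle_congr _ e, encircle_biproduct, sum_decomposition e fun i => encircle i.rep m.rep,
    Finset.sum_smul]
  refine Finset.sum_congr rfl fun i _ => ?_
  rw [mul_smul, chi_smul, Nat.cast_smul_eq_nsmul]

/-- A loop around the trivial strand contributes its dimension. -/
theorem chi_unitClass (P : C) : chi (unitClass C) P = dim P := by
  refine chi_eq ?_
  have h := encircle_naturality P (unitIso C).inv
  rw [encircle_unit, ribbonTrace_eq_tr, Linear.comp_smul, Category.comp_id] at h
  rw [← cancel_mono (unitIso C).inv, ← h, dim]
  simp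

theorem sMatrix_eq (i j : SimpleClass C) : sMatrix C i j = dim i.rep * chi i j.rep := by
  rw [sMatrix, tr, ribbonTrace_braiding, ← tr, ← chi_smul, tr_smul_id, mul_comm]

theorem dim_mul_chi_comm (i j : SimpleClass C) :
    dim i.rep * chi i j.rep = dim j.rep * chi j i.rep := by
  rw [← sMatrix_eq, ← sMatrix_eq, sMatrix, sMatrix, tr_comm]

end Characters

/-! ### Duality, integrality and orthogonality of the characters -/

section Duality

variable {C : Type u} [Category.{v} C] [Abelian C] [Linear ℂ C]
  [MonoidalCategory C] [MonoidalPreadditive C] [MonoidalLinear ℂ C]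

theorem finrank_tensorLeft_hom (X Y Y' Z : C) [ExactPairing Y Y'] :
    Module.finrank ℂ (Y' ⊗ X ⟶ Z) = Module.finrank ℂ (X ⟶ Y ⊗ Z) :=
  ((tensorLeftHomEquiv X Y Y' Z).toLinearEquiv (R := ℂ)
    ⟨fun f g => by simp [tensorLeftHomEquiv], fun c f => by simp [tensorLeftHomEquiv]⟩).finrank_eq

theorem finrank_tensorRight_hom (X Y Y' Z : C) [ExactPairing Y Y'] :
    Module.finrank ℂ (X ⊗ Y ⟶ Z) = Module.finrank ℂ (X ⟶ Z ⊗ Y') :=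
  ((tensorRightHomEquiv X Y Y' Z).toLinearEquiv (R := ℂ)
    ⟨fun f g => by simp [tensorRightHomEquiv], fun c f => by simp [tensorRightHomEquiv]⟩).finrank_eq

variable [RigidCategory C] [IsFusionCategory C]

/-- Frobenius reciprocity for the fusion coefficients. -/
theorem mult_tensor_comm (i j k : SimpleClass C) :
    mult k (i.rep ⊗ j.rep) = mult j ((i.rep)ᘁ ⊗ k.rep) := by
  rw [mult, mult, ← finrank_tensorLeft_hom _ _ (i.rep)ᘁ, finrank_hom_comm]

theorem mult_unitClass (m : SimpleClass C) : mult (unitClass C) (m.rep ⊗ (m.rep)ᘁ) = 1 := by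
  rw [mult, finrank_hom_congr (unitIso C).symm (Iso.refl _), ← finrank_tensorRight_hom _ m.rep,
    finrank_hom_congr (λ_ m.rep) (Iso.refl _)]
  exact finrank_endomorphism_simple_eq_one ℂ _

end Duality

section Modular

open ComplexConjugate

variable {C : Type u} [Category.{v} C] [Abelian C] [Linear ℂ C]
  [MonoidalCategory C] [MonoidalPreadditive C] [MonoidalLinear ℂ C] [RigidCategory C]
  [IsFusionCategory C] [BraidedCategory C] [RibbonCategory C]

theorem chi_congr (m : SimpleClass C) {P Q : C} (e : P ≅ Q) : chi m P = chi m Q :=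
  chi_eq (by rw [encircle_congr _ e, chi_smul])

theorem sum_mult_mul_chi (m i j : SimpleClass C) :
    ∑ k, (mult k (i.rep ⊗ j.rep) : ℂ) * chi m k.rep = chi m i.rep * chi m j.rep := by
  rw [← chi_eq_sum, chi_tensor]

/-- By Frobenius reciprocity, the transpose of the matrix of multiplication by `i` is the matrix of
multiplication by the dual of `i`. -/
theorem sum_mult_mul_chi' (m i k : SimpleClass C) :
    ∑ j : SimpleClass C, (mult k (i.rep ⊗ j.rep) : ℂ) * chi m j.rep =
      chi m (i.rep)ᘁ * chi m k.rep := by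
  simp only [mult_tensor_comm]
  rw [← chi_eq_sum, chi_tensor]

theorem sum_mult_mul_dim (i j : SimpleClass C) :
    ∑ k, (mult k (i.rep ⊗ j.rep) : ℂ) * dim k.rep = dim i.rep * dim j.rep := by
  simp only [← chi_unitClass, sum_mult_mul_chi]

theorem sum_mult_mul_dim' (i k : SimpleClass C) :
    ∑ j : SimpleClass C, (mult k (i.rep ⊗ j.rep) : ℂ) * dim j.rep = dim i.rep * dim k.rep := by
  rw [← dim_rightDual i.rep]
  simp only [← chi_unitClass, sum_mult_mul_chi']

/-- Multiplication by `chi m i.rep` preserves the subgroup of `ℂ` spanned by the values of the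
character, which is finitely generated, and nonzero by the hypothesis on the unit. -/
theorem isIntegral_chi (m i : SimpleClass C) (hm : chi m (unitClass C).rep = 1) :
    IsIntegral ℤ (chi m i.rep) := by
  let N : Submodule ℤ ℂ := Submodule.span ℤ (Set.range fun j : SimpleClass C => chi m j.rep)
  refine isIntegral_of_smul_mem_submodule (N := N) ?_ ?_ _ ?_
  · intro h
    have h1 : chi m (unitClass C).rep ∈ N := Submodule.subset_span ⟨_, rfl⟩
    rw [h, hm] at h1
    simp at h1
  · exact Submodule.fg_span (Set.finite_range _)
  · intro x hx
    induction hx using Submodule.span_induction with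
    | mem x hx =>
      obtain ⟨j, rfl⟩ := hx
      rw [smul_eq_mul, ← sum_mult_mul_chi]
      refine Submodule.sum_mem _ fun k _ => ?_
      rw [← nsmul_eq_mul]
      exact Submodule.smul_of_tower_mem _ _ (Submodule.subset_span ⟨k, rfl⟩)
    | zero => simp
    | add x y _ _ hx hy => rw [smul_add]; exact N.add_mem hx hy
    | smul a x _ hx => rw [smul_comm]; exact N.smul_mem a hx

/-- The vector of values of a character is an eigenvector of the matrix of multiplication by `i` and
of its transpose. Pairing it with its complex conjugate compares the two eigenvalues. -/
theorem chi_rightDual (m i : SimpleClass C) (hm : chi m (unitClass C).rep = 1) :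
    chi m (i.rep)ᘁ = conj (chi m i.rep) := by
  have h1 : ∑ k : SimpleClass C, ∑ j : SimpleClass C,
      conj (chi m k.rep) * ((mult k (i.rep ⊗ j.rep) : ℂ) * chi m j.rep) =
      chi m (i.rep)ᘁ * ∑ k : SimpleClass C, conj (chi m k.rep) * chi m k.rep := by
    simp only [← Finset.mul_sum, sum_mult_mul_chi']
    rw [Finset.mul_sum]
    exact Finset.sum_congr rfl fun k _ => by ring
  have h2 : ∑ k : SimpleClass C, ∑ j : SimpleClass C,
      conj (chi m k.rep) * ((mult k (i.rep ⊗ j.rep) : ℂ) * chi m j.rep) =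
      conj (chi m i.rep) * ∑ k : SimpleClass C, conj (chi m k.rep) * chi m k.rep := by
    rw [Finset.sum_comm, Finset.mul_sum]
    refine Finset.sum_congr rfl fun j _ => ?_
    have := congrArg conj (sum_mult_mul_chi m i j)
    simp only [map_sum, map_mul, Complex.conj_natCast] at this
    rw [← mul_assoc, ← this, Finset.sum_mul]
    exact Finset.sum_congr rfl fun k _ => by ring
  have h3 : ∑ k : SimpleClass C, conj (chi m k.rep) * chi m k.rep ≠ 0 := by
    have h4 : ∑ k : SimpleClass C, conj (chi m k.rep) * chi m k.rep =
        ((∑ k : SimpleClass C, Complex.normSq (chi m k.rep) : ℝ) : ℂ) := by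
      simp [Complex.normSq_eq_conj_mul_self]
    rw [h4, Complex.ofReal_ne_zero]
    refine (Finset.sum_pos' (fun k _ => Complex.normSq_nonneg _)
      ⟨unitClass C, Finset.mem_univ _, ?_⟩).ne'
    rw [hm]
    simp
  exact mul_right_cancel₀ h3 (h1.symm.trans h2)

variable [IsModular C]

theorem exists_sMatrix_ne_zero (i : SimpleClass C) : ∃ j, sMatrix C i j ≠ 0 := by
  by_contra! h
  exact IsModular.det_sMatrix_ne_zero (C := C) (Matrix.det_eq_zero_of_row_eq_zero i h)

theorem dim_ne_zero (i : SimpleClass C) : dim i.rep ≠ 0 := by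
  obtain ⟨j, hj⟩ := exists_sMatrix_ne_zero i
  rw [sMatrix_eq] at hj
  exact left_ne_zero_of_mul hj

theorem chi_unit (m : SimpleClass C) : chi m (unitClass C).rep = 1 := by
  obtain ⟨j, hj⟩ := exists_sMatrix_ne_zero m
  rw [sMatrix_eq] at hj
  have h := chi_tensor m (unitClass C).rep j.rep
  rw [chi_congr m (whiskerRightIso (unitIso C).symm j.rep ≪≫ λ_ j.rep)] at h
  exact mul_right_cancel₀ (right_ne_zero_of_mul hj) (h.symm.trans (one_mul _).symm)

theorem dim_unit : dim (unitClass C).rep = 1 := by rw [← chi_unitClass, chi_unit]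

theorem conj_dim (i : SimpleClass C) : conj (dim i.rep) = dim i.rep := by
  rw [← chi_unitClass, ← chi_rightDual _ _ (chi_unit _), chi_unitClass, chi_unitClass,
    dim_rightDual]

/-- Orthogonality of the character of `k` to the dimension character. The element `∑ i, d_i i` of the
fusion ring absorbs every `x` up to the factor `d_x`, so a character that does not kill it equals
the dimension; then the rows of `k` and of the unit in the s-matrix are proportional. -/
theorem sum_dim_mul_chi {k : SimpleClass C} (hk : k ≠ unitClass C) :
    ∑ i : SimpleClass C, dim i.rep * chi k i.rep = 0 := by
  by_contra h0
  have h1 : ∀ x : SimpleClass C, chi k x.rep = dim x.rep := by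
    intro x
    refine mul_right_cancel₀ h0 ?_
    have h2 : ∑ i : SimpleClass C, ∑ j : SimpleClass C,
        dim i.rep * ((mult j (x.rep ⊗ i.rep) : ℂ) * chi k j.rep) =
        chi k x.rep * ∑ i : SimpleClass C, dim i.rep * chi k i.rep := by
      simp only [← Finset.mul_sum, sum_mult_mul_chi]
      rw [Finset.mul_sum]
      exact Finset.sum_congr rfl fun k _ => by ring
    have h3 : ∑ i : SimpleClass C, ∑ j : SimpleClass C,
        dim i.rep * ((mult j (x.rep ⊗ i.rep) : ℂ) * chi k j.rep) =
        dim x.rep * ∑ i : SimpleClass C, dim i.rep * chi k i.rep := by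
      rw [Finset.sum_comm, Finset.mul_sum]
      refine Finset.sum_congr rfl fun j _ => ?_
      rw [← mul_assoc, ← sum_mult_mul_dim', Finset.sum_mul]
      exact Finset.sum_congr rfl fun k _ => by ring
    exact h2.symm.trans h3
  refine IsModular.det_sMatrix_ne_zero (C := C) ?_
  have h4 := Matrix.det_updateRow_add_smul_self (sMatrix C) hk (-dim k.rep)
  rw [← h4]
  refine Matrix.det_eq_zero_of_row_eq_zero k fun j => ?_
  simp [sMatrix_eq, h1, chi_unitClass, dim_unit]

/-- The norm of a row of the s-matrix. By `chi_tensor` it is `∑ i, d_i² χ_i(m ⊗ m*)`, and by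
`sum_dim_mul_chi` only the summand `𝟙` of `m ⊗ m*` contributes to it. -/
theorem dim_sq_mul_sum (m : SimpleClass C) :
    dim m.rep ^ 2 * ∑ i : SimpleClass C, chi m i.rep * conj (chi m i.rep) = globalDim C := by
  have h1 : ∀ i : SimpleClass C, dim m.rep ^ 2 * (chi m i.rep * conj (chi m i.rep)) =
      ∑ k, (mult k (m.rep ⊗ (m.rep)ᘁ) : ℂ) * (dim k.rep * (dim i.rep * chi k i.rep)) := by
    intro i
    have h2 := dim_mul_chi_comm m i
    have h3 := congrArg conj h2
    simp only [map_mul, conj_dim] at h3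
    rw [← chi_rightDual _ m (chi_unit _)] at h3
    calc dim m.rep ^ 2 * (chi m i.rep * conj (chi m i.rep))
        = (dim m.rep * chi m i.rep) * (dim m.rep * conj (chi m i.rep)) := by ring
      _ = dim i.rep ^ 2 * chi i (m.rep ⊗ (m.rep)ᘁ) := by rw [h2, h3, chi_tensor]; ring
      _ = _ := by
        rw [chi_eq_sum, Finset.mul_sum]
        refine Finset.sum_congr rfl fun k _ => ?_
        rw [mul_left_comm (dim k.rep), dim_mul_chi_comm k i]
        ring
  rw [Finset.mul_sum, Finset.sum_congr rfl fun i _ => h1 i, Finset.sum_comm,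
    Finset.sum_eq_single (unitClass C)]
  · simp [mult_unitClass, dim_unit, chi_unitClass, globalDim, sq]
  · intro k _ hk
    simp only [← Finset.mul_sum, sum_dim_mul_chi hk, mul_zero]
  · simp

end Modular

/-! ### The lantern relation and its determinant -/

section Lantern

/-- The double braiding of `X ⊗ Y` with `Z` is the product of a conjugate of that of `X` with `Z` and
of that of `Y` with `Z`. -/
theorem doubleBraiding_tensor {C : Type u} [Category.{v} C] [MonoidalCategory C]
    [BraidedCategory C] (X Y Z : C) :
    (β_ (X ⊗ Y) Z).hom ≫ (β_ Z (X ⊗ Y)).hom =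
      ((α_ X Y Z ≪≫ whiskerLeftIso X (β_ Y Z) ≪≫ (α_ X Z Y).symm).hom ≫
        ((β_ X Z).hom ≫ (β_ Z X).hom) ▷ Y ≫
        (α_ X Y Z ≪≫ whiskerLeftIso X (β_ Y Z) ≪≫ (α_ X Z Y).symm).inv) ≫
      ((α_ X Y Z).hom ≫ X ◁ ((β_ Y Z).hom ≫ (β_ Z Y).hom) ≫ (α_ X Y Z).inv) := by
  simp

variable {C : Type u} [Category.{v} C] [Abelian C] [Linear ℂ C]
  [MonoidalCategory C] [MonoidalPreadditive C] [MonoidalLinear ℂ C] [RigidCategory C]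
  [IsFusionCategory C] [BraidedCategory C] [RibbonCategory C]

theorem exists_theta (i : SimpleClass C) : ∃ t : ℂˣ, (t : ℂ) • 𝟙 i.rep = tw i.rep := by
  obtain ⟨c, hc⟩ := exists_smul_id i (tw i.rep)
  refine ⟨Units.mk0 c ?_, hc⟩
  rintro rfl
  rw [zero_smul] at hc
  apply id_nonzero i.rep
  rw [← tw_twInv i.rep, ← hc, zero_comp]

/-- The scalar by which the twist acts on the simple object `i`. -/
def theta (i : SimpleClass C) : ℂˣ := (exists_theta i).choose

theorem theta_smul (i : SimpleClass C) : (theta i : ℂ) • 𝟙 i.rep = tw i.rep :=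
  (exists_theta i).choose_spec

theorem detHom_tw (w : SimpleClass C) (P : C) :
    detHom w.rep (tw P) = (theta w : ℂ) ^ Module.finrank ℂ (w.rep ⟶ P) := by
  rw [← detHom_smul_id, detHom, detHom]
  congr 1
  ext f
  simp only [Linear.rightComp_apply, Linear.comp_smul, Category.comp_id]
  rw [tw_naturality, ← theta_smul, Linear.smul_comp, Category.id_comp]

instance (Z : C) : (tensorRight Z).Linear ℂ where

instance (Z : C) : (tensorLeft Z).Linear ℂ where

theorem detHom_whiskerRight (w : SimpleClass C) (P Z : C) :
    detHom w.rep (tw P ▷ Z) =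
      ∏ r, (theta r : ℂ) ^ (mult r P * mult w (r.rep ⊗ Z)) :=
  detHom_map (tensorRight Z) w.rep (twist C).hom (fun r => theta r) (fun r => (theta_smul r).symm) P

theorem detHom_whiskerLeft (w : SimpleClass C) (Z P : C) :
    detHom w.rep (Z ◁ tw P) =
      ∏ r, (theta r : ℂ) ^ (mult r P * mult w (Z ⊗ r.rep)) :=
  detHom_map (tensorLeft Z) w.rep (twist C).hom (fun r => theta r) (fun r => (theta_smul r).symm) P

theorem tw_tensor_rep (i j : SimpleClass C) :
    tw (i.rep ⊗ j.rep) ≫ (β_ i.rep j.rep).hom ≫ (β_ j.rep i.rep).hom =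
      ((theta i : ℂ) * theta j) • 𝟙 _ := by
  rw [tw_tensor, ← theta_smul, ← theta_smul, MonoidalCategory.tensorHom_def]
  simp [smul_smul, mul_comm]

/-- The determinant of the lantern relation on the space of morphisms from `w` to `(i ⊗ j) ⊗ k`. -/
theorem theta_pow_eq_prod (i j k w : SimpleClass C) :
    ((theta w : ℂ) * theta i * theta j * theta k) ^
        (∑ r, mult r (i.rep ⊗ j.rep) * mult w (r.rep ⊗ k.rep)) =
      (∏ r, (theta r : ℂ) ^ (mult r (i.rep ⊗ j.rep) * mult w (r.rep ⊗ k.rep))) *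
      (∏ r, (theta r : ℂ) ^ (mult r (i.rep ⊗ k.rep) * mult w (r.rep ⊗ j.rep))) *
      ∏ r, (theta r : ℂ) ^ (mult r (j.rep ⊗ k.rep) * mult w (i.rep ⊗ r.rep)) := by
  rw [← detHom_whiskerRight, ← detHom_whiskerRight, ← detHom_whiskerLeft]
  set X := i.rep
  set Y := j.rep
  set Z := k.rep
  have hn : ∑ r, mult r (X ⊗ Y) * mult w (r.rep ⊗ Z) =
      Module.finrank ℂ (w.rep ⟶ (X ⊗ Y) ⊗ Z) := (finrank_hom_map (tensorRight Z) _ _).symm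
  rw [hn]
  set n := Module.finrank ℂ (w.rep ⟶ (X ⊗ Y) ⊗ Z)
  -- Each double braiding is replaced by twists, using the balancing axiom for `(X ⊗ Y) ⊗ Z`,
  -- `X ⊗ Z` and `Y ⊗ Z`.
  have h1 := congrArg (detHom w.rep) (tw_tensor (X ⊗ Y) Z)
  have h2 : tw (X ⊗ Y) ⊗ₘ tw Z = (theta k : ℂ) • 𝟙 _ ≫ tw (X ⊗ Y) ▷ Z := by
    have hk : (theta k : ℂ) • 𝟙 Z = tw Z := theta_smul k
    rw [← hk, MonoidalCategory.tensorHom_def]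
    simp
  rw [← Linear.smul_comp] at h2
  rw [h2, doubleBraiding_tensor, detHom_comp, detHom_tw, detHom_comp, detHom_comp,
    detHom_smul_id, detHom_conj, detHom_conj] at h1
  have h3 : detHom w.rep (tw (X ⊗ Z) ▷ Y) * detHom w.rep (((β_ X Z).hom ≫ (β_ Z X).hom) ▷ Y) =
      ((theta i : ℂ) * theta k) ^ n := by
    rw [← detHom_comp, ← comp_whiskerRight, tw_tensor_rep, MonoidalLinear.smul_whiskerRight,
      id_whiskerRight, detHom_smul_id]
    congr 1
    exact finrank_hom_congr (Iso.refl _)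
      (α_ X Y Z ≪≫ whiskerLeftIso X (β_ Y Z) ≪≫ (α_ X Z Y).symm).symm
  have h4 : detHom w.rep (X ◁ tw (Y ⊗ Z)) * detHom w.rep (X ◁ ((β_ Y Z).hom ≫ (β_ Z Y).hom)) =
      ((theta j : ℂ) * theta k) ^ n := by
    rw [← detHom_comp, ← MonoidalCategory.whiskerLeft_comp, tw_tensor_rep,
      MonoidalLinear.whiskerLeft_smul, MonoidalCategory.whiskerLeft_id, detHom_smul_id]
    congr 1
    exact finrank_hom_congr (Iso.refl _) (α_ X Y Z).symm
  have h5 : (theta k : ℂ) ^ n ≠ 0 := pow_ne_zero _ (Units.ne_zero _)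
  apply mul_left_cancel₀ h5
  calc _ = (theta w : ℂ) ^ n * ((theta i : ℂ) * theta k) ^ n * ((theta j : ℂ) * theta k) ^ n := by
        ring
    _ = _ := by
      rw [← h3, ← h4]
      linear_combination (detHom w.rep (tw (X ⊗ Z) ▷ Y) * detHom w.rep (X ◁ tw (Y ⊗ Z))) * h1

end Lantern

section Sums

variable {I R : Type*} [Fintype I] [DecidableEq I] [CommRing R]

/-- The identity between structure constants `N` of a ring with basis `I` and a dimension function `d`
by which the lantern relations, weighted by `d j * d k * d w`, add up to a relation for `i` alone: the
terms of `w`, `j`, `k` and the three products on the right all contribute `d i * d r ^ 2 * D`. -/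
theorem weighted_sum (N : I → I → I → R) (d : I → R)
    (ha : ∀ i j, ∑ k, N i j k * d k = d i * d j) (hb : ∀ i k, ∑ j, N i j k * d j = d i * d k)
    (i r : I) :
    ∑ j, ∑ k, ∑ w, d j * d k * d w *
      ((∑ s, N i j s * N s k w) * ((Pi.single w 1 : I → R) r +
        (Pi.single i 1 : I → R) r + (Pi.single j 1 : I → R) r +
        (Pi.single k 1 : I → R) r) -
      (N i j r * N r k w + N i k r * N r j w + N j k r * N i r w)) =
    (∑ j, d j ^ 2) ^ 2 * d i * (Pi.single i 1 : I → R) r := by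
  set D := ∑ j, d j ^ 2
  -- The multiplicities of `w` in `(i ⊗ j) ⊗ k`, summed over `w` or over `k`.
  have q1 : ∀ j k, ∑ w, (∑ s, N i j s * N s k w) * d w = d i * d j * d k := by
    intro j k
    simp only [Finset.sum_mul]
    rw [Finset.sum_comm]
    simp only [mul_assoc, ← Finset.mul_sum, ha]
    rw [← mul_assoc, ← ha, Finset.sum_mul]
    exact Finset.sum_congr rfl fun k _ => by ring
  have q2 : ∀ j w, ∑ k, (∑ s, N i j s * N s k w) * d k = d i * d j * d w := by
    intro j k
    simp only [Finset.sum_mul]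
    rw [Finset.sum_comm]
    simp only [mul_assoc, ← Finset.mul_sum, hb]
    rw [← mul_assoc, ← ha, Finset.sum_mul]
    exact Finset.sum_congr rfl fun k _ => by ring
  have e1 : ∑ j, ∑ k, ∑ w, d j * d k * d w * ((∑ s, N i j s * N s k w) * (Pi.single w 1 : I → R) r) =
      d i * d r ^ 2 * D := by
    have : ∀ j k, ∑ w, d j * d k * d w * ((∑ s, N i j s * N s k w) * (Pi.single w 1 : I → R) r) =
        d j * d r * ((∑ s, N i j s * N s k r) * d k) := by
      intro j k
      rw [Finset.sum_eq_single r]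
      · simp; ring
      · intro w _ hw; simp [Pi.single_eq_of_ne hw.symm]
      · simp
    simp only [this, ← Finset.mul_sum, q2]
    rw [Finset.mul_sum]
    exact Finset.sum_congr rfl fun k _ => by ring
  have e2 : ∑ j, ∑ k, ∑ w, d j * d k * d w * ((∑ s, N i j s * N s k w) * (Pi.single i 1 : I → R) r) =
      d i * D ^ 2 * (Pi.single i 1 : I → R) r := by
    have : ∀ j k, ∑ w, d j * d k * d w * ((∑ s, N i j s * N s k w) * (Pi.single i 1 : I → R) r) =
        d i * (Pi.single i 1 : I → R) r * d j ^ 2 * d k ^ 2 := by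
      intro j k
      calc _ = d j * d k * (Pi.single i 1 : I → R) r *
            ∑ w, (∑ s, N i j s * N s k w) * d w := by
              rw [Finset.mul_sum]
              exact Finset.sum_congr rfl fun k _ => by ring
        _ = _ := by rw [q1]; ring
    simp only [this, ← Finset.mul_sum, ← Finset.sum_mul]
    ring
  have e3 : ∑ j, ∑ k, ∑ w, d j * d k * d w * ((∑ s, N i j s * N s k w) * (Pi.single j 1 : I → R) r) =
      d i * d r ^ 2 * D := by
    rw [Finset.sum_eq_single r]
    · have : ∀ k, ∑ w, d r * d k * d w * ((∑ s, N i r s * N s k w) * (Pi.single r 1 : I → R) r) =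
          d i * d r ^ 2 * d k ^ 2 := by
        intro k
        calc _ = d r * d k * ∑ w, (∑ s, N i r s * N s k w) * d w := by
              rw [Finset.mul_sum]
              exact Finset.sum_congr rfl fun k _ => by simp; ring
          _ = _ := by rw [q1]; ring
      simp only [this, ← Finset.mul_sum]
      rfl
    · intro w _ hw; simp [Pi.single_eq_of_ne hw.symm]
    · simp
  have e4 : ∑ j, ∑ k, ∑ w, d j * d k * d w * ((∑ s, N i j s * N s k w) * (Pi.single k 1 : I → R) r) =
      d i * d r ^ 2 * D := by
    rw [Finset.sum_comm, Finset.sum_eq_single r]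
    · have : ∀ j, ∑ w, d j * d r * d w * ((∑ s, N i j s * N s r w) * (Pi.single r 1 : I → R) r) =
          d i * d r ^ 2 * d j ^ 2 := by
        intro k
        calc _ = d k * d r * ∑ w, (∑ s, N i k s * N s r w) * d w := by
              rw [Finset.mul_sum]
              exact Finset.sum_congr rfl fun k _ => by simp; ring
          _ = _ := by rw [q1]; ring
      simp only [this, ← Finset.mul_sum]
      rfl
    · intro w _ hw; simp [Pi.single_eq_of_ne hw.symm]
    · simp
  have f1 : ∑ j, ∑ k, ∑ w, d j * d k * d w * (N i j r * N r k w) = d i * d r ^ 2 * D := by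
    have : ∀ j k, ∑ w, d j * d k * d w * (N i j r * N r k w) =
        (N i j r * d j) * (d r * d k ^ 2) := by
      intro j k
      calc _ = d j * d k * N i j r * ∑ w, N r k w * d w := by
              rw [Finset.mul_sum]
              exact Finset.sum_congr rfl fun k _ => by ring
        _ = _ := by rw [ha]; ring
    simp only [this, ← Finset.mul_sum, ← Finset.sum_mul, hb]
    ring
  have f2 : ∑ j, ∑ k, ∑ w, d j * d k * d w * (N i k r * N r j w) = d i * d r ^ 2 * D := by
    rw [← f1, Finset.sum_comm]
    simp only [mul_comm (d _) (d _)]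
  have f3 : ∑ j, ∑ k, ∑ w, d j * d k * d w * (N j k r * N i r w) = d i * d r ^ 2 * D := by
    have : ∀ j k, ∑ w, d j * d k * d w * (N j k r * N i r w) =
        (d j * d i * d r) * (N j k r * d k) := by
      intro j k
      calc _ = d j * d k * N j k r * ∑ w, N i r w * d w := by
              rw [Finset.mul_sum]
              exact Finset.sum_congr rfl fun k _ => by ring
        _ = _ := by rw [ha]; ring
    simp only [this, ← Finset.mul_sum, hb]
    rw [Finset.mul_sum]
    exact Finset.sum_congr rfl fun k _ => by ring
  simp only [mul_sub, mul_add, Finset.sum_sub_distrib, Finset.sum_add_distrib, e1, e2, e3, e4,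
    f1, f2, f3]
  ring

end Sums

/-! ### Powers with algebraic integer exponents -/

section AlgIntPowers

/-- If `g ^ a = 1`, then the order of `g` divides `a`. For `g` of infinite order `orderOf g` is `0`, and
the claim is that `a = 0`. By flatness of the algebraic integers, `a ⊗ g = 0` is explained by a
relation `a = ∑ z_j y_j` with integers `z_j` such that `g ^ z_j = 1`. -/
theorem PowEqOne.orderOf_dvd {G : Type*} [CommGroup G] {g : G} {a : AlgInt} (h : PowEqOne g a) :
    (orderOf g : AlgInt) ∣ a := by
  have h0 : ∑ _i : Unit, Additive.ofMul g ⊗ₜ[ℤ] a = 0 := by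
    have := congrArg (TensorProduct.comm ℤ AlgInt (Additive G)) h
    simpa using this
  obtain ⟨k, z, y, hy, hz⟩ :=
    TensorProduct.vanishesTrivially_of_sum_tmul_eq_zero_of_rTensor_injective ℤ
      (m := fun _ : Unit => Additive.ofMul g) (n := fun _ : Unit => a)
      (Module.Flat.rTensor_preserves_injective_linearMap _ (Submodule.subtype_injective _)) h0
  rw [show a = _ from hy ()]
  refine Finset.dvd_sum fun j _ => ?_
  have h1 : g ^ z () j = 1 := by simpa [← ofMul_zpow] using hz j
  obtain ⟨c, hc⟩ := orderOf_dvd_iff_zpow_eq_one.2 h1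
  rw [hc, zsmul_eq_mul]
  exact Dvd.intro ((c : AlgInt) * y j) (by push_cast; ring)

theorem powEqOne_of_dvd {G : Type*} [CommGroup G] {g : G} {n : ℕ} {a : AlgInt} (hg : g ^ n = 1)
    (h : (n : AlgInt) ∣ a) : PowEqOne g a := by
  obtain ⟨b, rfl⟩ := h
  rw [PowEqOne, mul_comm, ← nsmul_eq_mul', ← natCast_zsmul, TensorProduct.smul_tmul,
    natCast_zsmul, ← ofMul_pow, hg, ofMul_one,
    TensorProduct.tmul_zero]

theorem powEqOne_pi {ι : Type*} [Finite ι] {G : ι → Type*} [∀ i, CommGroup (G i)] {g : ∀ i, G i}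
    {a : AlgInt} (h : ∀ i, PowEqOne (g i) a) : PowEqOne g a := by
  classical
  have := Fintype.ofFinite ι
  have h1 : Additive.ofMul g =
      ∑ i, (MonoidHom.toAdditive (MonoidHom.mulSingle G i)).toIntLinearMap
        (Additive.ofMul (g i)) := by
    have := congrArg Additive.ofMul (Finset.univ_prod_mulSingle g).symm
    rw [ofMul_prod] at this
    exact this
  rw [PowEqOne, h1, TensorProduct.tmul_sum]
  refine Finset.sum_eq_zero fun i _ => ?_
  rw [← LinearMap.lTensor_tmul, (h i : _ ⊗ₜ[ℤ] _ = _), map_zero]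

end AlgIntPowers

/-! ### The order of the twist -/

section Twist

variable {C : Type u} [Category.{v} C] [Abelian C] [Linear ℂ C]
  [MonoidalCategory C] [MonoidalPreadditive C] [MonoidalLinear ℂ C] [RigidCategory C]
  [IsFusionCategory C]

/-- Endomorphisms of the identity functor are determined by their components at simple objects. -/
theorem natTrans_ext {α β : 𝟭 C ⟶ 𝟭 C} (h : ∀ i : SimpleClass C, α.app i.rep = β.app i.rep) :
    α = β := by
  ext P
  obtain ⟨n, c, ⟨e⟩⟩ := exists_decomposition P
  have h1 : α.app (⨁ fun k => (c k).rep) = β.app (⨁ fun k => (c k).rep) := by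
    refine biproduct.hom_ext' _ _ fun k => ?_
    exact (α.naturality _).trans
      ((congrArg (· ≫ biproduct.ι (fun k => (c k).rep) k) (h (c k))).trans (β.naturality _).symm)
  have h2 : e.hom ≫ α.app _ = α.app P ≫ e.hom := α.naturality e.hom
  have h3 : e.hom ≫ β.app _ = β.app P ≫ e.hom := β.naturality e.hom
  exact (cancel_mono e.hom).1 (h2.symm.trans ((congrArg (e.hom ≫ ·) h1).trans h3))

variable [BraidedCategory C] [RibbonCategory C]

theorem twist_pow_app (i : SimpleClass C) (n : ℕ) :
    (twist C ^ n).hom.app i.rep = ((theta i ^ n : ℂˣ) : ℂ) • 𝟙 i.rep := by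
  induction n with
  | zero => simp; rfl
  | succ n ih =>
    have : (twist C ^ (n + 1)).hom.app i.rep = tw i.rep ≫ (twist C ^ n).hom.app i.rep := by
      rw [pow_succ]; rfl
    rw [this, ih, ← theta_smul, pow_succ]
    simp [smul_smul]

theorem twist_pow_eq_one_iff (n : ℕ) :
    twist C ^ n = 1 ↔ (theta : SimpleClass C → ℂˣ) ^ n = 1 := by
  constructor
  · intro h
    ext i
    have h1 := twist_pow_app i n
    rw [h] at h1
    refine smul_id_injective i.rep (h1.symm.trans ?_)
    simp; rfl
  · intro h
    apply Iso.ext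
    refine natTrans_ext fun i => ?_
    have h1 : theta i ^ n = 1 := congrFun h i
    rw [twist_pow_app, h1]
    simp; rfl

theorem orderOf_twist : orderOf (twist C) = orderOf (theta : SimpleClass C → ℂˣ) :=
  orderOf_eq_orderOf_iff.2 twist_pow_eq_one_iff

end Twist

/-! ### The powers of the twists of simple objects -/

section Vanishing

open ComplexConjugate

variable {C : Type u} [Category.{v} C] [Abelian C] [Linear ℂ C]
  [MonoidalCategory C] [MonoidalPreadditive C] [MonoidalLinear ℂ C] [RigidCategory C]
  [IsFusionCategory C] [BraidedCategory C] [RibbonCategory C]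

/-- The twist of `i` in the extension of scalars of `ℂˣ` to the algebraic integers. -/
def tau (i : SimpleClass C) : AlgInt ⊗[ℤ] Additive ℂˣ := 1 ⊗ₜ[ℤ] Additive.ofMul (theta i)

/-- The multiplicity of `k` in `i ⊗ j`, as an algebraic integer. -/
def fusionCoeff (i j k : SimpleClass C) : AlgInt := (mult k (i.rep ⊗ j.rep) : ℕ)

/-- The relation `theta_pow_eq_prod` in additive form. -/
theorem sum_smul_tau_eq_zero (i j k w : SimpleClass C) :
    ∑ r, ((∑ s, fusionCoeff i j s * fusionCoeff s k w) *
      ((Pi.single w 1 : SimpleClass C → AlgInt) r +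
        (Pi.single i 1 : SimpleClass C → AlgInt) r + (Pi.single j 1 : SimpleClass C → AlgInt) r +
        (Pi.single k 1 : SimpleClass C → AlgInt) r) -
      (fusionCoeff i j r * fusionCoeff r k w + fusionCoeff i k r * fusionCoeff r j w +
        fusionCoeff j k r * fusionCoeff i r w)) •
        tau r = 0 := by
  have h : (theta w * theta i * theta j * theta k) ^
        (∑ r, mult r (i.rep ⊗ j.rep) * mult w (r.rep ⊗ k.rep)) =
      (∏ r, theta r ^ (mult r (i.rep ⊗ j.rep) * mult w (r.rep ⊗ k.rep))) *
      (∏ r, theta r ^ (mult r (i.rep ⊗ k.rep) * mult w (r.rep ⊗ j.rep))) *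
      ∏ r, theta r ^ (mult r (j.rep ⊗ k.rep) * mult w (i.rep ⊗ r.rep)) := by
    ext
    simpa using theta_pow_eq_prod i j k w
  have h1 := congrArg (fun g : ℂˣ =>
    TensorProduct.mk ℤ AlgInt (Additive ℂˣ) 1 (Additive.ofMul g)) h
  simp only [ofMul_mul, ofMul_pow, ofMul_prod, map_add, map_nsmul, map_sum,
    TensorProduct.mk_apply] at h1
  have h2 : ∀ x : SimpleClass C,
      ∑ r, (Pi.single x 1 : SimpleClass C → AlgInt) r • tau r = tau x := by
    intro x
    rw [Finset.sum_eq_single x]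
    · simp
    · intro r _ hr; simp [Pi.single_eq_of_ne hr]
    · simp
  simp only [sub_smul, Finset.sum_sub_distrib]
  simp only [mul_smul _ (_ + _), ← Finset.smul_sum, add_smul, Finset.sum_add_distrib, h2]
  simp only [fusionCoeff, ← Nat.cast_mul, ← Nat.cast_sum, Nat.cast_smul_eq_nsmul, tau]
  rw [h1, sub_self]

variable [IsModular C]

variable (C) in
/-- The global dimension as a real number; the real parts lose nothing, since the dimensions are real
(see `globalDim_eq`). -/
def realGlobalDim : ℝ := ∑ i : SimpleClass C, (dim i.rep).re ^ 2

theorem ofReal_re_dim (i : SimpleClass C) : ((dim i.rep).re : ℂ) = dim i.rep :=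
  Complex.conj_eq_iff_re.1 (conj_dim i)

variable (C) in
theorem globalDim_eq : globalDim C = (realGlobalDim C : ℂ) := by
  simp [globalDim, realGlobalDim, ofReal_re_dim]

variable (C) in
theorem realGlobalDim_pos : 0 < realGlobalDim C := by
  refine Finset.sum_pos' (fun i _ => sq_nonneg _) ⟨unitClass C, Finset.mem_univ _, ?_⟩
  simp [dim_unit]

theorem isIntegral_dim (i : SimpleClass C) : IsIntegral ℤ (dim i.rep) := by
  rw [← chi_unitClass]
  exact isIntegral_chi _ _ (chi_unit _)

/-- The categorical dimension of `i` as an algebraic integer. -/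
def algDim (i : SimpleClass C) : AlgInt := ⟨dim i.rep, isIntegral_dim i⟩

/-- The square of `√D / d_i` is a sum of products of character values. -/
theorem isIntegral_sqrt_div (i : SimpleClass C) :
    IsIntegral ℤ (((√(realGlobalDim C) : ℝ) : ℂ) / dim i.rep) := by
  have h : (((√(realGlobalDim C) : ℝ) : ℂ) / dim i.rep) ^ 2 =
      ∑ j : SimpleClass C, chi i j.rep * conj (chi i j.rep) := by
    rw [div_pow, div_eq_iff (pow_ne_zero 2 (dim_ne_zero i)), mul_comm, dim_sq_mul_sum,
      globalDim_eq, ← Complex.ofReal_pow, Real.sq_sqrt (realGlobalDim_pos C).le]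
  refine IsIntegral.of_pow two_pos ?_
  rw [h]
  refine IsIntegral.sum _ fun j _ => ?_
  have h1 := isIntegral_chi i j (chi_unit i)
  exact h1.mul (h1.map ((starRingEnd ℂ).toIntAlgHom))

theorem sq_globalDim_smul_tau (i : SimpleClass C) :
    ((∑ j : SimpleClass C, algDim j ^ 2) ^ 2 * algDim i) • tau i = 0 := by
  have ha : ∀ i j : SimpleClass C, ∑ k, fusionCoeff i j k * algDim k = algDim i * algDim j := by
    intro i j
    apply Subtype.ext
    simpa [fusionCoeff, algDim] using sum_mult_mul_dim i j
  have hb : ∀ i k : SimpleClass C, ∑ j, fusionCoeff i j k * algDim j = algDim i * algDim k := by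
    intro i j
    apply Subtype.ext
    simpa [fusionCoeff, algDim] using sum_mult_mul_dim' i j
  have h1 : ∑ r, ((∑ j : SimpleClass C, algDim j ^ 2) ^ 2 * algDim i *
      (Pi.single i 1 : SimpleClass C → AlgInt) r) • tau r = 0 := by
    simp only [← weighted_sum fusionCoeff algDim ha hb, Finset.sum_smul]
    rw [Finset.sum_comm]
    refine Finset.sum_eq_zero fun j _ => ?_
    rw [Finset.sum_comm]
    refine Finset.sum_eq_zero fun k _ => ?_
    rw [Finset.sum_comm]
    refine Finset.sum_eq_zero fun w _ => ?_
    simp only [mul_smul (algDim j * algDim k * algDim w)]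
    rw [← Finset.smul_sum, sum_smul_tau_eq_zero, smul_zero]
  rw [Finset.sum_eq_single i] at h1
  · simpa using h1
  · intro r _ hr; simp [Pi.single_eq_of_ne hr]
  · simp

/-- The exponent factors as `D^{5/2} = (√D / d_i) · (D² d_i)`, and `D² d_i` already kills `τ_i`. -/
theorem powEqOne_theta (i : SimpleClass C) (a : AlgInt)
    (ha : (a : ℂ) = ((realGlobalDim C ^ (5 / 2 : ℝ) : ℝ) : ℂ)) : PowEqOne (theta i) a := by
  have h1 : a = (⟨_, isIntegral_sqrt_div i⟩ : AlgInt) *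
      ((∑ j : SimpleClass C, algDim j ^ 2) ^ 2 * algDim i) := by
    apply Subtype.ext
    have h2 : ((∑ j : SimpleClass C, algDim j ^ 2 : AlgInt) : ℂ) = (realGlobalDim C : ℂ) := by
      rw [← globalDim_eq]
      simp [algDim, globalDim]
    have h3 : realGlobalDim C ^ (5 / 2 : ℝ) = √(realGlobalDim C) * realGlobalDim C ^ 2 := by
      rw [Real.sqrt_eq_rpow, ← Real.rpow_natCast, ← Real.rpow_add (realGlobalDim_pos C)]
      norm_num
    simp only [MulMemClass.coe_mul, SubmonoidClass.coe_pow]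
    rw [h2, ha, h3, algDim, Complex.ofReal_mul, Complex.ofReal_pow]
    field_simp [dim_ne_zero i]
  have h2 : a ⊗ₜ[ℤ] Additive.ofMul (theta i) = a • tau i := by
    rw [tau, TensorProduct.smul_tmul', smul_eq_mul, mul_one]
  rw [PowEqOne, h2, h1, mul_smul, sq_globalDim_smul_tau, smul_zero]

variable (C) in
theorem isIntegral_globalDim_rpow :
    IsIntegral ℤ ((realGlobalDim C ^ (5 / 2 : ℝ) : ℝ) : ℂ) := by
  refine IsIntegral.of_pow two_pos ?_
  have h : (5 / 2 : ℝ) * (2 : ℕ) = (5 : ℕ) := by norm_num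
  rw [← Complex.ofReal_pow, ← Real.rpow_natCast, ← Real.rpow_mul (realGlobalDim_pos C).le, h,
    Real.rpow_natCast, Complex.ofReal_pow, ← globalDim_eq]
  exact (IsIntegral.sum _ fun (i : SimpleClass C) _ => (isIntegral_dim i).pow 2).pow 5

end Vanishing

end VafaTwist

end

theorem mainTheorem2 {C : Type*} [Category C] [Abelian C] [Linear ℂ C]
    [MonoidalCategory C] [MonoidalPreadditive C] [MonoidalLinear ℂ C] [RigidCategory C]
    [VafaTwist.IsFusionCategory C] [BraidedCategory C] [VafaTwist.RibbonCategory C]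
    [VafaTwist.IsModular C] :
    ∃ D : ℝ, 0 < D ∧ VafaTwist.globalDim C = (D : ℂ) ∧
      ∃ a : VafaTwist.AlgInt, (a : ℂ) = ((D ^ (5 / 2 : ℝ) : ℝ) : ℂ) ∧
        IsOfFinOrder (VafaTwist.twist C) ∧
        (orderOf (VafaTwist.twist C) : VafaTwist.AlgInt) ∣ a ∧
        (∀ X : C, Simple X → ∃ t : ℂˣ,
          (VafaTwist.twist C).hom.app X = (t : ℂ) • 𝟙 X ∧ VafaTwist.PowEqOne t a) ∧
        (∀ X : C, VafaTwist.PowEqOne (VafaTwist.twistAt X) a) := by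
  open VafaTwist in
  let a : AlgInt := ⟨_, isIntegral_globalDim_rpow C⟩
  have ha : ∀ i : SimpleClass C, PowEqOne (theta i) a := fun i => powEqOne_theta i a rfl
  have hdvd : (orderOf (twist C) : AlgInt) ∣ a := by
    rw [orderOf_twist]
    exact (powEqOne_pi (g := theta) ha).orderOf_dvd
  refine ⟨realGlobalDim C, realGlobalDim_pos C, globalDim_eq C, a, rfl, ?_, hdvd, ?_, ?_⟩
  · rw [← orderOf_pos_iff, pos_iff_ne_zero]
    intro h0
    rw [h0, Nat.cast_zero, zero_dvd_iff] at hdvd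
    have h1 : ((realGlobalDim C ^ (5 / 2 : ℝ) : ℝ) : ℂ) = 0 := congrArg Subtype.val hdvd
    rw [Complex.ofReal_eq_zero] at h1
    exact (Real.rpow_pos_of_pos (realGlobalDim_pos C) _).ne' h1
  · intro X hX
    obtain ⟨i, ⟨e⟩⟩ := exists_iso_rep X
    refine ⟨theta i, ?_, ha i⟩
    change tw X = _
    rw [← cancel_mono e.hom, ← tw_naturality, ← theta_smul]
    simp
  · intro X
    refine powEqOne_of_dvd (n := orderOf (twist C)) ?_ hdvd
    let φ : Aut (𝟭 C) →* Aut X :=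
      { toFun := fun f => Iso.app f X, map_one' := rfl, map_mul' := fun _ _ => rfl }
    apply Subtype.ext
    have h1 : twistAut X = φ (twist C) := rfl
    change twistAut X ^ orderOf (twist C) = 1
    rw [h1, ← map_pow, pow_orderOf_eq_one, map_one]
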